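/- **Conventions.** Groups are abelian and $p$ is a prime. $\mathfrak K^{rs(p)}$ is the class of reduced separable $p$-groups, i.e. groups $G$ in which every element has order a power of $p$, which have no nonzero divisible subgroup, and in which no nonzero element has infinite height (if $x\in\bigcap_n p^nG$ then $x=0$). $\mathfrak K^{rs(p)}_\lambda$ is the class of those of cardinality $\lambda$. An embedding of groups is an injective homomorphism (not necessarily with pure image). A universal member of $\mathfrak K^{rs(p)}_\lambda$ is an $H\in\mathfrak K^{rs(p)}_\lambda$ into which every $G\in\mathfrak K^{rs(p)}$ with $|G|\le\lambda$ embeds. For a $p$-group $G$ let $\lambda_n(G)=\dim_{\mathbb Z/p\mathbb Z}\,(p^nG)[p]/(p^{n+1}G)[p]$, where $A[p]=\{x\in A: px=0\}$. For cardinals $\bar\lambda=\langle\lambda_i:i\le\omega\rangle$, $\mathfrak K^{fc}_{\bar\lambda}$ is the class of structures $M=(|M|,P_i,F_n)_{i\le\omega,\,n<\omega}$ such that $|M|$ is the disjoint union of the sets $P_i$ $(i\le\omega)$, $|P_i|\le\lambda_i$, and $F_n$ is a function from $P_\omega$ to $P_n$. An embedding is an injective map that sends each $P_i$ into the corresponding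 $P_i$ and commutes with all $F_n$. $\mathfrak K^{fc}_\lambda$ is the case in which $\lambda_i=\lambda$ for all $i\le\omega$. A structure $M$ is universal for $\mathfrak K^{fc}_{\bar\lambda}$ if every member of $\mathfrak K^{fc}_{\bar\lambda}$ embeds into $M$; a universal member of $\mathfrak K^{fc}_{\bar\lambda}$ is a member that is universal for it. In the same way, a universal member of a class of groups all of the same cardinality is a member into which every member embeds. For $\bar n=\langle n_i:i<\omega\rangle$ with $1\le n_i<\omega$ let $J^2_{\bar n}$ be the ideal of nowhere dense subsets of $\prod_{i<\omega}n_i$ (product of discrete spaces), and let $T^{\aleph_0}_{J^2_{\bar n}}(\lambda)$ be the least cardinality of a family $\mathcal P$ of countable subsets of $\lambda$ such that for every $f:\prod_i n_i\to\lambda$ there is $Y\in\mathcal P$ with $f^{-1}(Y)\notin J^2_{\bar n}$. **Theorem.** Let $p$ be a prime and $\lambda\ge 2^{\aleph_0}$, and assume $T^{\aleph_0}_{J^2_{\bar n}}(\lambda)=\lambda$ for every such $\bar n$. Let $\lambda_n\le\lambda_{n+1}\le\lambda_\omega=\lambda$ for all $n<\omega$, $\lambda\le\prod_{n<\omega}\lambda_n$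 and $\bar\lambda=\langle\lambda_i:i\le\omega\rangle$. 1. If there is a universal member of $\mathfrak K^{fc}_{\bar\lambda}$, then there is a universal member of $\mathfrak K^{rs(p)}_\lambda$. 2. If some member of $\mathfrak K^{fc}_\lambda$ is universal for $\mathfrak K^{fc}_{\bar\lambda}$, then there is a group $H$ that is at the same time a universal member of $\{G\in\mathfrak K^{rs(p)}_\lambda:\lambda_n(G)\le\lambda_n\text{ for all }n<\omega\}$, of $\{G\in\mathfrak K^{rs(p)}_\lambda:\lambda_n(G)\le\lambda\text{ for all }n<\omega\}$, and of $\mathfrak K^{rs(p)}_\lambda$. -/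

import Mathlib

open Cardinal

universe u v

/-! ### Covering numbers modulo an ideal -/

/-- The family of nowhere dense subsets of `∏ i, n i` (each finite factor `n i = {0, …, n i - 1}`
discrete, the product with the product topology, so the sets `{ν | ν ↾ k = η ↾ k}` form a basis). -/
def nowhereDenseIdeal (n : ℕ → ℕ) : Set (Set (∀ i, Fin (n i))) :=
  {A | IsNowhereDense A}

/-- The cardinal `U_I^{κ}(μ)` (also written `T_I^{κ}(μ)`) for a downward closed family `I` of subsets
of `X`: the least cardinality of a family `P` of subsets of (a set of cardinality) `μ`, each of
cardinality at most `κ`, such that every `f : X → μ` satisfies `{x | f x ∈ Y} ∉ I` for some `Y ∈ P`.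
(It would be `0` if there were no such family at all.) -/
noncomputable def coveringNumber {X : Type v} (I : Set (Set X)) (κ μ : Cardinal.{u}) :
    Cardinal.{u} :=
  sInf {c | ∃ P : Set (Set μ.out),
    (∀ Y ∈ P, #Y ≤ κ) ∧ (∀ f : X → μ.out, ∃ Y ∈ P, f ⁻¹' Y ∉ I) ∧ #P = c}

/-! ### The structures with `ω + 1` kinds of elements -/

/-- A structure `(|M|, P_i, F_n)`, `i ≤ ω`, `n < ω`, whose universe is the disjoint union of the sets
`P_i` and where `F_n` is a function from `P_ω` to `P_n`. The universe is represented by its parts: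
`P n` is `P_n` for `n < ω` and `Pω` is `P_ω`. The identity function `F_ω` is omitted. -/
structure FcStructure : Type (u + 1) where
  P : ℕ → Type u
  Pω : Type u
  F : ∀ n, Pω → P n

/-- `M` belongs to the class given by `⟨l i : i ≤ ω⟩`, where `l ω = lam`:
`|P_n| ≤ l n` for `n < ω` and `|P_ω| ≤ lam`. -/
def FcStructure.InClass (M : FcStructure.{u}) (l : ℕ → Cardinal.{u}) (lam : Cardinal.{u}) : Prop :=
  (∀ n, #(M.P n) ≤ l n) ∧ #M.Pω ≤ lam

/-- `N` embeds into `M`: there is a one-to-one map of the universes that maps each part into the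
part of the same index and commutes with all the functions `F_n`. -/
def FcStructure.EmbedsInto (N M : FcStructure.{u}) : Prop :=
  ∃ (g : ∀ n, N.P n → M.P n) (gω : N.Pω → M.Pω),
    (∀ n, Function.Injective (g n)) ∧ Function.Injective gω ∧
      ∀ n x, M.F n (gω x) = g n (N.F n x)

/-! ### Reduced separable `p`-groups -/

/-- `G` is a reduced separable (abelian) `p`-group. -/
structure IsReducedSeparable (p : ℕ) (G : Type u) [AddCommGroup G] : Prop where
  /-- every element has order a power of `p` -/
  isPGroup : ∀ x : G, ∃ n : ℕ, p ^ n • x = 0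
  /-- there is no nonzero divisible subgroup -/
  reduced : ∀ D : AddSubgroup G,
    (∀ m : ℕ, m ≠ 0 → ∀ x ∈ D, ∃ y ∈ D, m • y = x) → D = ⊥
  /-- no nonzero element has infinite height -/
  separable : ∀ x : G, (∀ n : ℕ, ∃ y : G, p ^ n • y = x) → x = 0

/-- The subgroup `(p ^ n G)[p]` of the elements of `p ^ n G` that are annihilated by `p`. -/
def heightSocle (p n : ℕ) (G : Type u) [AddCommGroup G] : AddSubgroup G :=
  (nsmulAddMonoidHom (α := G) (p ^ n)).range ⊓ (nsmulAddMonoidHom (α := G) p).ker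

/-- The quotient `(p ^ n G)[p] / (p ^ (n + 1) G)[p]`. -/
abbrev heightSocleQuotient (p n : ℕ) (G : Type u) [AddCommGroup G] : Type u :=
  heightSocle p n G ⧸ (heightSocle p (n + 1) G).addSubgroupOf (heightSocle p n G)

theorem heightSocleQuotient_nsmul (p n : ℕ) (G : Type u) [AddCommGroup G]
    (x : heightSocleQuotient p n G) : p • x = 0 := by
  induction x using QuotientAddGroup.induction_on with
  | H x =>
    have h : p • x = 0 := Subtype.ext x.2.2
    rw [← QuotientAddGroup.mk_nsmul, h, QuotientAddGroup.mk_zero]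

/-- The invariant `λ_n(G)`: the dimension of `(p ^ n G)[p] / (p ^ (n + 1) G)[p]` over `ℤ/pℤ`. -/
noncomputable def ulmInvariant (p n : ℕ) (G : Type u) [AddCommGroup G] : Cardinal.{u} :=
  letI : Module (ZMod p) (heightSocleQuotient p n G) :=
    AddCommGroup.zmodModule (heightSocleQuotient_nsmul p n G)
  Module.rank (ZMod p) (heightSocleQuotient p n G)

/-- The group `G` embeds into the group `H` (not necessarily purely). -/
def GroupEmbeds (G H : Type u) [AddCommGroup G] [AddCommGroup H] : Prop :=
  ∃ f : G →+ H, Function.Injective f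

/-- `H` is a universal member of the class of reduced separable `p`-groups of cardinality `lam`:
it belongs to the class, and every reduced separable `p`-group of cardinality at most `lam`
embeds into `H`. -/
def IsUniversalRs (p : ℕ) (lam : Cardinal.{u}) (H : Type u) [AddCommGroup H] : Prop :=
  (IsReducedSeparable p H ∧ #H = lam) ∧
    ∀ (G : Type u) [AddCommGroup G], IsReducedSeparable p G → #G ≤ lam → GroupEmbeds G H

/-- `G` is a reduced separable `p`-group of cardinality `lam` with `λ_n(G) ≤ l n` for all `n`. -/
def InRsClass (p : ℕ) (l : ℕ → Cardinal.{u}) (lam : Cardinal.{u}) (G : Type u) [AddCommGroup G] :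
    Prop :=
  IsReducedSeparable p G ∧ #G = lam ∧ ∀ n, ulmInvariant p n G ≤ l n

/-- `H` is a universal member of the class `InRsClass p l lam`. -/
def IsUniversalInRsClass (p : ℕ) (l : ℕ → Cardinal.{u}) (lam : Cardinal.{u}) (H : Type u)
    [AddCommGroup H] : Prop :=
  InRsClass p l lam H ∧ ∀ (G : Type u) [AddCommGroup G], InRsClass p l lam G → GroupEmbeds G H

/-! ### Criteria for reduced separable groups -/

/-! Embeddings need not preserve heights, so every group in question fits into T(I), the torsion
part of ∏ₘ ⨁_{I m} ℤ/p^(m+1), with |I m| = λ_m. For each n the bounded group G/pⁿG embeds into an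
infinite block of coordinates, λ ≤ ∏ λ_m provides the room, and separability makes these maps
jointly injective (`exists_embedding_torsionProduct`).

T(I) may have more than λ elements. Each element has finite support in every coordinate; the
branches through these supports, at most 2^ℵ₀ per element, form the P_ω of a structure N with P_m =
I m. Embedding N into the universal M relabels coordinates. By the covering hypothesis one of λ many
countable sets Y of branches of M covers almost all supports of the relabelled element
(`mem_branchSupported_of_forall_branch`). At most λ elements are so supported on a given Y
(`mk_branchSupported_le`), so together they generate a group of size at most λ, whose part in the
torsion product receives every G (`exists_universal_of_universal_fcStructure`).

To bound the λ_n, this group is embedded back into T(I) and enlarged there to a pure subgroup of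
size λ; purity gives λ_n ≤ |I n| (`ulmInvariant_le_of_pure`). -/

theorem IsReducedSeparable.of_isPGroup_of_separable {p : ℕ} (hp : p ≠ 0) {G : Type u}
    [AddCommGroup G] (h₁ : ∀ x : G, ∃ n : ℕ, p ^ n • x = 0)
    (h₂ : ∀ x : G, (∀ n : ℕ, ∃ y : G, p ^ n • y = x) → x = 0) : IsReducedSeparable p G where
  isPGroup := h₁
  reduced D hD := (AddSubgroup.eq_bot_iff_forall D).2 fun x hx => h₂ x fun n =>
    let ⟨y, _, hy⟩ := hD (p ^ n) (pow_ne_zero n hp) x hx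
    ⟨y, hy⟩
  separable := h₂

theorem IsReducedSeparable.of_injective {p : ℕ} (hp : p ≠ 0) {G H : Type u} [AddCommGroup G]
    [AddCommGroup H] (hH : IsReducedSeparable p H) (f : G →+ H) (hf : Function.Injective f) :
    IsReducedSeparable p G := by
  refine .of_isPGroup_of_separable hp (fun x => ?_) fun x hx => hf ?_
  · obtain ⟨n, hn⟩ := hH.isPGroup (f x)
    exact ⟨n, hf (by rw [map_nsmul, hn, map_zero])⟩
  · rw [map_zero]
    refine hH.separable _ fun n => ?_
    obtain ⟨y, rfl⟩ := hx n
    exact ⟨f y, (map_nsmul f _ _).symm⟩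

/-! ### Cardinalities -/

theorem AddSubgroup.mk_closure_le {G : Type u} [AddCommGroup G] (s : Set G) :
    #(AddSubgroup.closure s) ≤ max #s ℵ₀ := by
  rcases s.eq_empty_or_nonempty with rfl | hs
  · simp
  have : Nonempty s := hs.to_subtype
  have h : (AddSubgroup.closure s : Set G)
      = Set.range (Finsupp.linearCombination ℤ ((↑) : s → G)) := by
    rw [← Submodule.span_int_eq_addSubgroupClosure, Submodule.coe_toAddSubgroup,
      ← LinearMap.coe_range, Finsupp.range_linearCombination, Subtype.range_coe]
  calc #(AddSubgroup.closure s) = #(Set.range (Finsupp.linearCombination ℤ ((↑) : s → G))) := by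
        rw [← h]; rfl
    _ ≤ #(s →₀ ℤ) := mk_range_le
    _ = max #s ℵ₀ := by rw [mk_finsupp_lift_of_infinite']; simp

theorem Cardinal.mk_iUnion_le_of_le {α : Type u} {ι : Type v} {f : ι → Set α} {c : Cardinal.{u}}
    (hc : ℵ₀ ≤ c) (hι : lift.{u} #ι ≤ lift.{v} c) (hf : ∀ i, #(f i) ≤ c) : #(⋃ i, f i) ≤ c := by
  rw [← lift_le.{v}]
  have hc' : ℵ₀ ≤ lift.{v} c := by simpa using hc
  exact (mk_iUnion_le_lift f).trans
    (mul_le_of_le hc' hι (ciSup_le' fun i => lift_le.2 (hf i)))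

/-- A subgroup of `T` is contained in one of the same size (up to `ℵ₀`) closed under those
solutions of equations `m • z = x` that exist in `T`. -/
theorem AddSubgroup.exists_pure_le {X : Type u} [AddCommGroup X] (T K₀ : AddSubgroup X)
    (hK : K₀ ≤ T) {c : Cardinal.{u}} (hc : ℵ₀ ≤ c) (hKc : #K₀ ≤ c) :
    ∃ K : AddSubgroup X, K₀ ≤ K ∧ K ≤ T ∧ #K ≤ c ∧
      ∀ (m : ℕ), ∀ x ∈ K, ∀ y ∈ T, m • y = x → ∃ z ∈ K, m • z = x := by
  classical
  -- Where no solution exists the value is `0`, so that adjoining the chosen values never leaves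
  -- `T`.
  have hr : ∀ (m : ℕ) (x : X), ∃ z ∈ T, ∀ y ∈ T, m • y = x → m • z = x := fun m x => by
    by_cases h : ∃ y ∈ T, m • y = x
    · obtain ⟨y, hy, rfl⟩ := h
      exact ⟨y, hy, fun _ _ _ => rfl⟩
    · exact ⟨0, T.zero_mem, fun y hy hyx => (h ⟨y, hy, hyx⟩).elim⟩
  choose r hrT hr using hr
  let step : AddSubgroup X → AddSubgroup X := fun A => AddSubgroup.closure (A ∪ ⋃ m, r m '' A)
  obtain ⟨S, hS0, hS⟩ : ∃ S : ℕ → AddSubgroup X, S 0 = K₀ ∧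
      ∀ k, S (k + 1) = AddSubgroup.closure (S k ∪ ⋃ m, r m '' S k) :=
    ⟨fun k => step^[k] K₀, rfl, fun k => Function.iterate_succ_apply' step k K₀⟩
  have hmono : Monotone S := monotone_nat_of_le_succ fun k x hx => by
    rw [hS]; exact AddSubgroup.subset_closure (Or.inl hx)
  have hdir : Directed (· ≤ ·) S := hmono.directed_le
  have hST : ∀ k, S k ≤ T := by
    intro k
    induction k with
    | zero => exact hS0.trans_le hK
    | succ k ih =>
      rw [hS, AddSubgroup.closure_le]
      refine Set.union_subset ih (Set.iUnion_subset fun m => ?_)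
      rintro _ ⟨x, -, rfl⟩
      exact hrT m x
  have hScard : ∀ k, #(S k) ≤ c := by
    intro k
    induction k with
    | zero => rwa [hS0]
    | succ k ih =>
      rw [hS]
      refine (AddSubgroup.mk_closure_le _).trans (max_le ?_ hc)
      refine (mk_union_le _ _).trans (add_le_of_le hc ih ?_)
      exact mk_iUnion_le_of_le hc (by simpa using hc) fun m => mk_image_le.trans ih
  refine ⟨⨆ k, S k, hS0.symm.trans_le (le_iSup S 0), iSup_le hST, ?_, fun m x hx y hy hyx => ?_⟩
  · have h : #(⋃ k, (S k : Set X)) ≤ c := mk_iUnion_le_of_le hc (by simpa using hc) hScard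
    rwa [← AddSubgroup.coe_iSup_of_directed hdir] at h
  · obtain ⟨k, hk⟩ := (AddSubgroup.mem_iSup_of_directed hdir).1 hx
    refine ⟨r m x, (AddSubgroup.mem_iSup_of_directed hdir).2 ⟨k + 1, ?_⟩, hr m x y hy hyx⟩
    rw [hS]
    exact AddSubgroup.subset_closure (Or.inr (Set.mem_iUnion.2 ⟨m, x, hk, rfl⟩))

/-! ### Torsion elements of products of direct sums of cyclic groups -/

/-- The torsion subgroup of `∏ m, ⨁ (i : I m), ℤ/p^(m+1)`, where `ℤ/p^(m+1)` is realized as the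
subgroup of the circle annihilated by `p^(m+1)`. -/
def torsionProduct (p : ℕ) (I : ℕ → Type u) : AddSubgroup (∀ m, I m →₀ UnitAddCircle) where
  carrier := {x | (∀ m, p ^ (m + 1) • x m = 0) ∧ ∃ k : ℕ, p ^ k • x = 0}
  zero_mem' := by simp
  neg_mem' := by
    rintro x ⟨h, k, hk⟩
    exact ⟨fun m => by simp [h m], k, by simp [hk]⟩
  add_mem' := by
    rintro x y ⟨h, k, hk⟩ ⟨h', k', hk'⟩
    refine ⟨fun m => by simp [h m, h' m], k + k', ?_⟩
    rw [nsmul_add, pow_add, mul_nsmul, hk, mul_nsmul', hk', nsmul_zero, nsmul_zero, add_zero]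

theorem isReducedSeparable_torsionProduct {p : ℕ} (hp : p ≠ 0) (I : ℕ → Type u) :
    IsReducedSeparable p (torsionProduct p I) := by
  refine .of_isPGroup_of_separable hp (fun x => ?_) fun x hx => ?_
  · obtain ⟨k, hk⟩ := x.2.2
    exact ⟨k, Subtype.ext hk⟩
  · refine Subtype.ext (funext fun m => ?_)
    obtain ⟨y, rfl⟩ := hx (m + 1)
    exact y.2.1 m

theorem isReducedSeparable_of_le_torsionProduct {p : ℕ} (hp : p ≠ 0) {I : ℕ → Type u}
    {K : AddSubgroup (∀ m, I m →₀ UnitAddCircle)} (hK : K ≤ torsionProduct p I) :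
    IsReducedSeparable p K :=
  (isReducedSeparable_torsionProduct hp I).of_injective hp (AddSubgroup.inclusion hK)
    (AddSubgroup.inclusion_injective hK)

theorem UnitAddCircle.exists_toAddCircle_eq {p : ℕ} [NeZero p] {x : UnitAddCircle}
    (hx : p • x = 0) : ∃ a : ZMod p, ZMod.toAddCircle a = x := by
  obtain ⟨m, -, rfl⟩ := (AddCircle.nsmul_eq_zero_iff (NeZero.pos p)).1 hx
  exact ⟨m, by rw [ZMod.toAddCircle_natCast, mul_one]⟩

/-- The embedding of `⨁ ℤ/p` into a direct sum of circles. -/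
noncomputable def socleEmb (p : ℕ) [NeZero p] (α : Type u) :
    (α →₀ ZMod p) →+ (α →₀ UnitAddCircle) :=
  Finsupp.mapRange.addMonoidHom ZMod.toAddCircle

theorem socleEmb_injective (p : ℕ) [NeZero p] (α : Type u) :
    Function.Injective (socleEmb p α) :=
  Finsupp.mapRange_injective _ (map_zero _) (ZMod.toAddCircle_injective p)

theorem mem_range_socleEmb {p : ℕ} [NeZero p] {α : Type u} {x : α →₀ UnitAddCircle}
    (hx : p • x = 0) : x ∈ (socleEmb p α).range := by
  have h : ∀ t : UnitAddCircle, ∃ a : ZMod p, p • t = 0 → ZMod.toAddCircle a = t := fun t => by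
    by_cases ht : p • t = 0
    · obtain ⟨a, ha⟩ := UnitAddCircle.exists_toAddCircle_eq ht
      exact ⟨a, fun _ => ha⟩
    · exact ⟨0, fun h => (ht h).elim⟩
  choose a ha using h
  have hx' : ∀ i, p • x i = 0 := fun i => by simpa using DFunLike.congr_fun hx i
  refine ⟨Finsupp.onFinset x.support (fun i => a (x i)) fun i hi => ?_,
    Finsupp.ext fun i => ha _ (hx' i)⟩
  rw [Finsupp.mem_support_iff]
  intro h0
  apply hi
  apply ZMod.toAddCircle_injective p
  rw [ha _ (hx' i), h0, map_zero]

/-- Divisibility of the ambient group serves twice: to extend homomorphisms from socles, and to find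
the roots needed for the Ulm invariants. -/
theorem Finsupp.surjective_nsmul_circle {α : Type u} {n : ℕ} (hn : n ≠ 0) :
    Function.Surjective fun x : α →₀ UnitAddCircle => n • x := by
  intro x
  -- Taking `0` as the root of `0` keeps the support finite.
  have h : ∀ t : UnitAddCircle, ∃ s : UnitAddCircle, (t = 0 → s = 0) ∧ n • s = t := fun t => by
    by_cases ht : t = 0
    · exact ⟨0, fun _ => rfl, by simp [ht]⟩
    · obtain ⟨s, hs⟩ := DivisibleBy.surjective_smul UnitAddCircle ℤ (n := (n : ℤ))
        (by exact_mod_cast hn) t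
      exact ⟨s, fun h => (ht h).elim, by simpa using hs⟩
  choose s hs hs' using h
  exact ⟨x.mapRange s (hs 0 rfl), Finsupp.ext fun i => by simp [hs']⟩

/-- The Ulm invariants of a pure subgroup of `torsionProduct p I` are bounded by those of
`torsionProduct p I`. -/
theorem ulmInvariant_le_of_pure {p : ℕ} (hp : p.Prime) {I : ℕ → Type u}
    {K : AddSubgroup (∀ m, I m →₀ UnitAddCircle)} (hK : K ≤ torsionProduct p I)
    (hpure : ∀ (m : ℕ), ∀ x ∈ K, ∀ y ∈ torsionProduct p I, m • y = x → ∃ z ∈ K, m • z = x)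
    (n : ℕ) : ulmInvariant p n K ≤ #(I n) := by
  have : Fact p.Prime := ⟨hp⟩
  let h : heightSocle p n K →+ (I n →₀ UnitAddCircle) :=
    (Pi.evalAddMonoidHom _ n).comp (K.subtype.comp (heightSocle p n K).subtype)
  have hh : ∀ x, h x = x.1.1 n := fun _ => rfl
  have hsoc : ∀ x : heightSocle p n K, p • (x.1.1 : ∀ m, I m →₀ UnitAddCircle) = 0 := fun x =>
    congrArg Subtype.val (show p • x.1 = 0 from x.2.2)
  have hrange : ∀ x, h x ∈ (socleEmb p (I n)).range := fun x =>
    mem_range_socleEmb (congrFun (hsoc x) n)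
  -- A socle element of pⁿK vanishes in the coordinates below n, which pⁿ kills. It lies in pⁿ⁺¹K
  -- exactly when coordinate n vanishes too: the later coordinates can be divided by pⁿ⁺¹ in the
  -- torsion product, and purity moves the root into `K`.
  have hker : h.ker = (heightSocle p (n + 1) K).addSubgroupOf (heightSocle p n K) := by
    ext x
    rw [AddMonoidHom.mem_ker, AddSubgroup.mem_addSubgroupOf, hh]
    constructor
    · intro hx
      refine ⟨?_, x.2.2⟩
      obtain ⟨w, hw⟩ : ∃ w : K, p ^ n • w = x.1 := x.2.1
      have hlow : ∀ m ≤ n, x.1.1 m = 0 := fun m hm => by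
        rcases hm.lt_or_eq with hm | rfl
        · have h1 : x.1.1 m = p ^ n • w.1 m := by rw [← hw]; rfl
          obtain ⟨d, rfl⟩ := Nat.exists_eq_add_of_le (Nat.succ_le_of_lt hm)
          rw [h1, pow_add, mul_nsmul, Nat.succ_eq_add_one, (hK w.2).1 m, nsmul_zero]
        · exact hx
      -- The exponent n + 2 does not depend on m, so the roots assemble to a torsion element.
      have hz : ∀ m, ∃ z : I m →₀ UnitAddCircle, p ^ (n + 1) • z = x.1.1 m ∧
          p ^ (m + 1) • z = 0 ∧ p ^ (n + 2) • z = 0 := fun m => by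
        rcases le_or_gt m n with hm | hm
        · exact ⟨0, by simp [hlow m hm]⟩
        · obtain ⟨z, hz⟩ := Finsupp.surjective_nsmul_circle (pow_ne_zero (n + 1) hp.ne_zero)
            (x.1.1 m)
          have hz2 : p ^ (n + 2) • z = 0 := by
            rw [pow_succ, mul_nsmul, show p ^ (n + 1) • z = x.1.1 m from hz]
            exact congrFun (hsoc x) m
          refine ⟨z, hz, ?_, hz2⟩
          obtain ⟨d, rfl⟩ := Nat.exists_eq_add_of_lt hm
          rw [show n + d + 1 + 1 = n + 2 + d by ring, pow_add, mul_nsmul, hz2, nsmul_zero]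
      choose z hz1 hz2 hz3 using hz
      obtain ⟨y, hy, hyx⟩ := hpure (p ^ (n + 1)) x.1.1 x.1.2 z ⟨hz2, n + 2, funext hz3⟩ (funext hz1)
      exact ⟨⟨y, hy⟩, Subtype.ext hyx⟩
    · rintro ⟨⟨w, hw⟩, -⟩
      have hw' : p ^ (n + 1) • w.1 n = x.1.1 n :=
        congrFun (congrArg Subtype.val (show p ^ (n + 1) • w = x.1 from hw)) n
      rw [← hw', (hK w.2).1 n]
  let e := (AddMonoidHom.ofInjective (socleEmb_injective p (I n))).symm.toAddMonoidHom
  let g : heightSocle p n K →+ (I n →₀ ZMod p) := e.comp (h.codRestrict _ hrange)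
  have hg : ∀ x, g x = 0 ↔ h x = 0 := fun x => by
    have : g x = 0 ↔ h.codRestrict _ hrange x = 0 := by
      simp [g, e]
    rw [this, Subtype.ext_iff]; rfl
  have hgker : g.ker = (heightSocle p (n + 1) K).addSubgroupOf (heightSocle p n K) := by
    rw [← hker]; ext x; exact hg x
  let q : heightSocleQuotient p n K →+ (I n →₀ ZMod p) :=
    QuotientAddGroup.lift _ g hgker.ge
  have hq : Function.Injective q := by
    rw [injective_iff_map_eq_zero]
    intro x
    induction x using QuotientAddGroup.induction_on with
    | H x =>
      intro hx
      rw [QuotientAddGroup.eq_zero_iff, ← hgker]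
      exact hx
  let _ : Module (ZMod p) (heightSocleQuotient p n K) :=
    AddCommGroup.zmodModule (heightSocleQuotient_nsmul p n K)
  have := LinearMap.lift_rank_le_of_injective (q.toZModLinearMap p) hq
  rwa [lift_id, lift_id, rank_finsupp_self, lift_uzero] at this

/-! ### Embedding separable groups into torsion products -/

/-- Over a finite field an infinite space has the cardinality of its basis, so comparing
cardinalities compares dimensions. -/
theorem exists_linearMap_injective_of_mk_le {k : Type v} [Field k] [Finite k] {V W : Type u}
    [AddCommGroup V] [Module k V] [AddCommGroup W] [Module k W] [Infinite W] (h : #V ≤ #W) :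
    ∃ f : V →ₗ[k] W, Function.Injective f := by
  rw [← rank_le_iff_exists_linearMap]
  refine (rank_le_card k V).trans (h.trans ?_)
  let b := Module.Free.chooseBasis k W
  have hW : lift.{max u v} #W = lift.{u} #(Module.Free.ChooseBasisIndex k W →₀ k) :=
    lift_mk_eq'.2 ⟨b.repr.toEquiv⟩
  have hι : Infinite (Module.Free.ChooseBasisIndex k W) := by
    by_contra hfin
    rw [not_infinite_iff_finite] at hfin
    have : Finite (Module.Free.ChooseBasisIndex k W →₀ k) :=
      Finite.of_injective _ DFunLike.coe_injective
    exact not_finite_iff_infinite.2 ‹Infinite W› (Finite.of_equiv _ b.repr.symm.toEquiv)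
  rw [mk_finsupp_lift_of_infinite, max_eq_left, lift_lift] at hW
  · rw [Module.Free.rank_eq_card_chooseBasisIndex]
    exact (lift_inj.1 hW).le
  · refine (lift_le_aleph0.2 (mk_le_aleph0_iff.2 inferInstance)).trans ?_
    simp

theorem exists_addMonoidHom_injective_of_mk_le {p : ℕ} (hp : p.Prime) {V W : Type u}
    [AddCommGroup V] [AddCommGroup W] (hV : ∀ x : V, p • x = 0) (hW : ∀ x : W, p • x = 0)
    (hinf : ℵ₀ ≤ #W) (h : #V ≤ #W) : ∃ f : V →+ W, Function.Injective f := by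
  have : Fact p.Prime := ⟨hp⟩
  let _ : Module (ZMod p) V := AddCommGroup.zmodModule hV
  let _ : Module (ZMod p) W := AddCommGroup.zmodModule hW
  have : Infinite W := infinite_iff.2 hinf
  obtain ⟨f, hf⟩ := exists_linearMap_injective_of_mk_le (k := ZMod p) h
  exact ⟨f.toAddMonoidHom, hf⟩

/-- A nonzero kernel in a bounded p-group would meet the socle. -/
theorem AddMonoidHom.injective_of_injOn_socle {p n : ℕ} {A E : Type*} [AddCommGroup A]
    [AddCommGroup E] (hA : ∀ a : A, p ^ n • a = 0) (f : A →+ E)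
    (hf : ∀ a : A, p • a = 0 → f a = 0 → a = 0) : Function.Injective f := by
  rw [injective_iff_map_eq_zero]
  intro a ha
  have : ∀ k, p ^ k • a = 0 → a = 0 := fun k => by
    induction k with
    | zero => simp
    | succ k ih =>
      intro hk
      refine ih (hf _ ?_ ?_)
      · rwa [← mul_nsmul, ← pow_succ]
      · rw [map_nsmul, ha, nsmul_zero]
  exact this n (hA a)

noncomputable instance {ι : Type u} : DivisibleBy (ι →₀ UnitAddCircle) ℤ :=
  divisibleByOfSMulRightSurj _ _ fun {n} hn x => by
    obtain ⟨y, hy⟩ := Finsupp.surjective_nsmul_circle (Int.natAbs_ne_zero.2 hn) x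
    refine ⟨n.sign • y, ?_⟩
    change n • n.sign • y = x
    rw [smul_smul, Int.mul_sign_self, natCast_zsmul]
    exact hy

/-- The socle of `A` embeds into `W` by cardinality; divisibility of `E` extends this map to `A`,
and injectivity on the socle suffices. -/
theorem exists_embedding_of_bounded {p : ℕ} (hp : p.Prime) {n : ℕ} {A W E : Type u}
    [AddCommGroup A] [AddCommGroup W] [AddCommGroup E] [DivisibleBy E ℤ]
    (hA : ∀ a : A, p ^ n • a = 0) (hW : ∀ x : W, p • x = 0) (hinf : ℵ₀ ≤ #W) (hcard : #A ≤ #W)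
    (j : W →+ E) (hj : Function.Injective j) : ∃ f : A →+ E, Function.Injective f := by
  let K : AddSubgroup A := (nsmulAddMonoidHom (α := A) p).ker
  obtain ⟨f, hf⟩ := exists_addMonoidHom_injective_of_mk_le hp (V := K)
    (fun x => Subtype.ext x.2) hW hinf ((mk_subtype_le _).trans hcard)
  obtain ⟨g, hg⟩ := (Module.Baer.of_divisible E).extension_property_addMonoidHom
    K.subtype K.subtype_injective (j.comp f)
  refine ⟨g, g.injective_of_injOn_socle hA fun a ha hga => ?_⟩
  have h : j (f ⟨a, ha⟩) = 0 := (DFunLike.congr_fun hg ⟨a, ha⟩).symm.trans hga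
  have h' : (⟨a, ha⟩ : K) = 0 :=
    hf ((hj (h.trans (map_zero j).symm)).trans (map_zero f).symm)
  exact congrArg Subtype.val h'

theorem exists_embedding_pi_of_bounded {p : ℕ} (hp : p.Prime) {n : ℕ} {A : Type u}
    [AddCommGroup A] (hA : ∀ a : A, p ^ n • a = 0) {S : Type} {I : S → Type u}
    (hinf : ℵ₀ ≤ #(∀ s, I s →₀ ZMod p)) (hcard : #A ≤ #(∀ s, I s →₀ ZMod p)) :
    ∃ f : A →+ ∀ s, I s →₀ UnitAddCircle, Function.Injective f := by
  have : Fact p.Prime := ⟨hp⟩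
  refine exists_embedding_of_bounded hp hA
    (fun x => funext fun s => Finsupp.ext fun i => by simp) hinf hcard
    (AddMonoidHom.pi fun s => (socleEmb p (I s)).comp (Pi.evalAddMonoidHom _ s)) fun x y h =>
    funext fun s => socleEmb_injective p (I s) (congrFun h s)

/-- The j-th index of the n-th block is `Nat.pair n j` ≥ j, so by monotonicity its factor has room
for `I j`. -/
theorem mk_pi_le_mk_pi_block {p : ℕ} [Fact p.Prime] {I : ℕ → Type u}
    (hmono : Monotone fun m => #(I m)) (n : ℕ) :
    #(∀ m, I m) ≤ #(∀ s : {m : ℕ // m.unpair.1 = n}, I s →₀ ZMod p) := by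
  have e : ∀ m, Nonempty (I m.unpair.2 ↪ I m) := fun m => hmono (Nat.unpair_right_le m)
  replace e := fun m => (e m).some
  refine mk_le_of_injective
    (f := fun c s => Finsupp.single (e s (c s.1.unpair.2)) (1 : ZMod p)) fun c d h => ?_
  funext j
  have hj := congrFun h ⟨Nat.pair n j, by simp⟩
  have hj' := (e _).injective (Finsupp.single_left_injective (one_ne_zero) hj)
  have key : ∀ k, k = j → c k = d k → c j = d j := by rintro _ rfl h; exact h
  exact key _ (by simp) hj'

/-- The quotient G/pⁿG uses the coordinates m with `m.unpair.1 = n`. There n ≤ m, so p^(m+1) kills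
the image; the common kernel is ⋂ pⁿG = 0. -/
theorem exists_embedding_torsionProduct {p : ℕ} (hp : p.Prime) {I : ℕ → Type u}
    (hmono : Monotone fun m => #(I m)) (hinf : ℵ₀ ≤ #(∀ m, I m)) {G : Type u} [AddCommGroup G]
    (hG : IsReducedSeparable p G) (hcard : #G ≤ #(∀ m, I m)) :
    ∃ f : G →+ torsionProduct p I, Function.Injective f := by
  have : Fact p.Prime := ⟨hp⟩
  let R : ℕ → AddSubgroup G := fun n => (nsmulAddMonoidHom (α := G) (p ^ n)).range
  have hA : ∀ n, ∀ a : G ⧸ R n, p ^ n • a = 0 := fun n a => by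
    induction a using QuotientAddGroup.induction_on with
    | H x =>
      rw [← QuotientAddGroup.mk_nsmul, QuotientAddGroup.eq_zero_iff]
      exact ⟨x, rfl⟩
  have hex := fun n => exists_embedding_pi_of_bounded hp (hA n)
    (hinf.trans (mk_pi_le_mk_pi_block (p := p) hmono n))
    ((mk_quotient_le).trans (hcard.trans (mk_pi_le_mk_pi_block (p := p) hmono n)))
  choose f hf using hex
  let F : G →+ ∀ m, I m →₀ UnitAddCircle := AddMonoidHom.pi fun m =>
    (Pi.evalAddMonoidHom _ ⟨m, rfl⟩).comp ((f m.unpair.1).comp (QuotientAddGroup.mk' _))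
  have hF : ∀ x m, F x m = f m.unpair.1 (QuotientAddGroup.mk x) ⟨m, rfl⟩ := fun _ _ => rfl
  have hFT : ∀ x, F x ∈ torsionProduct p I := fun x => by
    refine ⟨fun m => ?_, ?_⟩
    · obtain ⟨d, hd⟩ := Nat.exists_eq_add_of_le ((Nat.unpair_left_le m).trans m.le_succ)
      have h := congrFun ((map_nsmul (f m.unpair.1) (p ^ m.unpair.1) (x : G ⧸ R _)).symm.trans
        ((congrArg _ (hA _ _)).trans (map_zero _))) ⟨m, rfl⟩
      rw [show m + 1 = m.unpair.1 + d from hd, pow_add, mul_nsmul, hF]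
      exact (congrArg _ h).trans (nsmul_zero _)
    · obtain ⟨k, hk⟩ := hG.isPGroup x
      exact ⟨k, by rw [← map_nsmul, hk, map_zero]⟩
  refine ⟨F.codRestrict _ hFT, ?_⟩
  rw [injective_iff_map_eq_zero]
  intro x hx
  have hx' : F x = 0 := congrArg Subtype.val hx
  refine hG.separable x fun n => ?_
  have h0 : f n (QuotientAddGroup.mk x) = 0 := funext fun ⟨m, hm⟩ => by
    subst hm
    exact congrFun hx' m
  exact (QuotientAddGroup.eq_zero_iff x).1 (hf n (h0.trans (map_zero _).symm))

/-! ### Families of countable sets covering modulo nowhere dense sets -/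

/-- There are only 2^ℵ₀ ≤ λ sequences n̄, so the union of their families still has size at most λ.
-/
theorem exists_covering_family {lam : Cardinal.{u}} (hcont : continuum ≤ lam)
    (hT : ∀ n : ℕ → ℕ, (∀ i, 1 ≤ n i) → coveringNumber (nowhereDenseIdeal n) ℵ₀ lam = lam)
    {B : Type u} (hB : #B ≤ lam) :
    ∃ P : Set (Set B), #P ≤ lam ∧ (∀ Y ∈ P, Y.Countable) ∧
      ∀ n : ℕ → ℕ, (∀ i, 1 ≤ n i) → ∀ f : (∀ i, Fin (n i)) → B,
        ∃ Y ∈ P, ¬ IsNowhereDense (f ⁻¹' Y) := by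
  have hlam : ℵ₀ ≤ lam := aleph0_le_continuum.trans hcont
  have hex : ∀ n : {n : ℕ → ℕ // ∀ i, 1 ≤ n i}, ∃ P : Set (Set lam.out),
      (∀ Y ∈ P, #Y ≤ ℵ₀) ∧
      (∀ f : (∀ i, Fin (n.1 i)) → lam.out, ∃ Y ∈ P, f ⁻¹' Y ∉ nowhereDenseIdeal n.1) ∧
      #P = lam := fun n => by
    -- The infimum of the empty set is 0, so a nonzero value shows that a covering family exists.
    have hne : (coveringNumber (nowhereDenseIdeal n.1) ℵ₀ lam) ≠ 0 := by
      rw [hT n.1 n.2]; exact (aleph0_pos.trans_le hlam).ne'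
    have hmem : coveringNumber (nowhereDenseIdeal n.1) ℵ₀ lam ∈ {c | ∃ P : Set (Set lam.out),
        (∀ Y ∈ P, #Y ≤ ℵ₀) ∧ (∀ f : (∀ i, Fin (n.1 i)) → lam.out,
          ∃ Y ∈ P, f ⁻¹' Y ∉ nowhereDenseIdeal n.1) ∧ #P = c} := by
      refine csInf_mem (Set.nonempty_iff_ne_empty.2 fun h => hne ?_)
      exact (congrArg sInf h).trans Cardinal.sInf_empty
    rwa [hT n.1 n.2] at hmem
  choose P hPc hPf hPcard using hex
  obtain ⟨e⟩ : Nonempty (B ↪ lam.out) := by rw [← Cardinal.le_def, mk_out]; exact hB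
  refine ⟨⋃ n, (e ⁻¹' ·) '' P n, ?_, fun Y hY => ?_, fun n hn f => ?_⟩
  · have hidx : #{n : ℕ → ℕ // ∀ i, 1 ≤ n i} ≤ continuum := (mk_subtype_le _).trans (by simp)
    refine mk_iUnion_le_of_le hlam ?_ fun n => mk_image_le.trans (hPcard n).le
    rw [lift_uzero]
    refine (lift_le.2 hidx).trans ?_
    simpa using hcont
  · obtain ⟨n, Z, hZ, rfl⟩ := Set.mem_iUnion.1 hY
    exact (le_aleph0_iff_set_countable.1 (hPc n Z hZ)).preimage_of_injOn e.injective.injOn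
  · obtain ⟨Y, hY, hf⟩ := hPf ⟨n, hn⟩ (e ∘ f)
    exact ⟨e ⁻¹' Y, Set.mem_iUnion.2 ⟨⟨n, hn⟩, Y, hY, rfl⟩, hf⟩

/-- The closure of `A` contains a basic open set, which restricts finitely many coordinates. Past
these, a point of it can be altered to any value j at m, and `A` meets the open set of points with
that value. -/
theorem exists_forall_coord_of_not_isNowhereDense {n : ℕ → ℕ} {A : Set (∀ i, Fin (n i))}
    (hA : ¬ IsNowhereDense A) : ∃ k, ∀ m ≥ k, ∀ j : Fin (n m), ∃ η ∈ A, η m = j := by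
  obtain ⟨η, hη⟩ := Set.nonempty_iff_ne_empty.2 hA
  obtain ⟨s, U, hU, hsub⟩ := isOpen_pi_iff.1 isOpen_interior η hη
  refine ⟨s.sup id + 1, fun m hm j => ?_⟩
  have hms : m ∉ s := fun h => by
    have := Finset.le_sup (f := id) h
    simp only [id] at this
    omega
  have hmem : Function.update η m j ∈ closure A := by
    refine interior_subset (hsub fun i hi => ?_)
    rw [Function.update_of_ne (by rintro rfl; exact hms hi)]
    exact (hU i hi).2
  have hopen : IsOpen ((fun ζ : ∀ i, Fin (n i) => ζ m) ⁻¹' {j}) :=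
    (isOpen_discrete {j}).preimage (continuous_apply m)
  obtain ⟨ζ, hζ, hζA⟩ := mem_closure_iff.1 hmem _ hopen (by simp)
  exact ⟨ζ, hζA, hζ⟩

/-! ### Elements supported on countably many branches -/

theorem mk_finsupp_circle_le {α : Type u} {c : Cardinal.{u}} (hc : continuum ≤ c) (h : #α ≤ c) :
    #(α →₀ UnitAddCircle) ≤ c := by
  have hsurj : Function.Surjective
      (Finsupp.mapRange.addMonoidHom (ι := α)
        (QuotientAddGroup.mk' (AddSubgroup.zmultiples (1 : ℝ)))) :=
    Finsupp.mapRange_surjective _ (map_zero _) (QuotientAddGroup.mk'_surjective _)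
  refine (mk_le_of_surjective hsurj).trans ?_
  rcases isEmpty_or_nonempty α with hα | hα
  · rw [mk_eq_one]
    exact one_le_aleph0.trans (aleph0_le_continuum.trans hc)
  · rw [mk_finsupp_lift_of_infinite', mk_real]
    simpa using ⟨h, hc⟩

/-- The elements almost all of whose coordinates are supported on the image of `Y`. -/
def branchSupported {B : Type u} {Q : ℕ → Type u} (F : ∀ m, B → Q m) (Y : Set B) :
    Set (∀ m, Q m →₀ UnitAddCircle) :=
  {x | ∃ k, ∀ m ≥ k, ((x m).support : Set (Q m)) ⊆ F m '' Y}

/-- For a fixed k, the first k coordinates allow at most c choices; the others have countable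
supporting sets and allow (2^ℵ₀)^ℵ₀ = 2^ℵ₀ in all. -/
theorem mk_branchSupported_le {B : Type u} {Q : ℕ → Type u} (F : ∀ m, B → Q m) {Y : Set B}
    (hY : Y.Countable) {c : Cardinal.{u}} (hc : continuum ≤ c) (hQ : ∀ m, #(Q m) ≤ c) :
    #(branchSupported F Y) ≤ c := by
  classical
  have hc0 : ℵ₀ ≤ c := aleph0_le_continuum.trans hc
  have heq : branchSupported F Y
      = ⋃ k, {x | ∀ m ≥ k, ((x m).support : Set (Q m)) ⊆ F m '' Y} := by
    ext x; simp [branchSupported]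
  rw [heq]
  refine mk_iUnion_le_of_le hc0 (by simpa using hc0) fun k => ?_
  let φ : {x : ∀ m, Q m →₀ UnitAddCircle | ∀ m ≥ k, ((x m).support : Set (Q m)) ⊆ F m '' Y} →
      (∀ m : Fin k, Q m →₀ UnitAddCircle) × (∀ m, (F m '' Y) →₀ UnitAddCircle) := fun x =>
    (fun m => x.1 m, fun m => (x.1 m).subtypeDomain (· ∈ F m '' Y))
  have hφ : Function.Injective φ := by
    intro x y h
    refine Subtype.ext (funext fun m => ?_)
    rcases lt_or_ge m k with hm | hm
    · exact congrFun (congrArg Prod.fst h) ⟨m, hm⟩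
    · have h2 := congrFun (congrArg Prod.snd h) m
      refine Finsupp.ext fun i => ?_
      by_cases hi : i ∈ F m '' Y
      · exact DFunLike.congr_fun h2 ⟨i, hi⟩
      · rw [Finsupp.notMem_support_iff.1 fun h' => hi (x.2 m hm h'),
          Finsupp.notMem_support_iff.1 fun h' => hi (y.2 m hm h')]
  refine (mk_le_of_injective hφ).trans ?_
  rw [mk_prod, lift_id, lift_id]
  refine mul_le_of_le hc0 ?_ ?_
  · rw [mk_pi]
    refine (prod_le_prod _ (fun _ => c) fun m : Fin k => mk_finsupp_circle_le hc (hQ m)).trans ?_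
    rw [prod_const]
    simpa using power_nat_le hc0
  · rw [mk_pi]
    refine (prod_le_prod _ (fun _ => continuum) fun m => mk_finsupp_circle_le le_rfl
      ((le_aleph0_iff_set_countable.2 (hY.image _)).trans aleph0_le_continuum)).trans ?_
    rw [prod_const]
    simpa using hc

/-! ### A universal group from a universal structure -/

/-- The η with `b η ∈ Y` are not nowhere dense, so from some level on the branches in `Y` pass
through the image of every point of `s m`. -/
theorem mem_branchSupported_of_forall_branch {B : Type u} {I Q : ℕ → Type u} {F : ∀ m, B → Q m}
    {P : Set (Set B)}
    (hP : ∀ n : ℕ → ℕ, (∀ i, 1 ≤ n i) → ∀ f : (∀ i, Fin (n i)) → B,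
      ∃ Y ∈ P, ¬ IsNowhereDense (f ⁻¹' Y))
    {s : ∀ m, Finset (I m)} (hs : ∀ m, (s m).Nonempty) {g : ∀ m, I m → Q m}
    (b : (∀ m, Fin (s m).card) → B)
    (hb : ∀ η m, F m (b η) = g m ((s m).equivFin.symm (η m)))
    {x : ∀ m, Q m →₀ UnitAddCircle}
    (hx : ∀ m, ((x m).support : Set (Q m)) ⊆ g m '' (s m : Set (I m))) :
    ∃ Y ∈ P, x ∈ branchSupported F Y := by
  obtain ⟨Y, hY, hd⟩ := hP (fun m => (s m).card) (fun m => (hs m).card_pos) b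
  obtain ⟨k, hk⟩ := exists_forall_coord_of_not_isNowhereDense hd
  refine ⟨Y, hY, k, fun m hm t ht => ?_⟩
  obtain ⟨i, hi, rfl⟩ := hx m ht
  obtain ⟨η, hη, hηm⟩ := hk m hm ((s m).equivFin ⟨i, hi⟩)
  exact ⟨b η, hη, by rw [hb, hηm, Equiv.symm_apply_apply]⟩

theorem exists_universal_of_universal_fcStructure {p : ℕ} (hp : p.Prime) {lam : Cardinal.{u}}
    {l : ℕ → Cardinal.{u}} (hcont : continuum ≤ lam)
    (hT : ∀ n : ℕ → ℕ, (∀ i, 1 ≤ n i) → coveringNumber (nowhereDenseIdeal n) ℵ₀ lam = lam)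
    (hmono : Monotone l) (hprod : lam ≤ Cardinal.prod l) {M : FcStructure.{u}}
    (hM : M.InClass (fun _ => lam) lam)
    (huniv : ∀ N : FcStructure.{u}, N.InClass l lam → N.EmbedsInto M) :
    ∃ (H : Type u) (_ : AddCommGroup H), IsReducedSeparable p H ∧ #H ≤ lam ∧
      ∀ (G : Type u) [AddCommGroup G], IsReducedSeparable p G → #G ≤ lam → GroupEmbeds G H := by
  classical
  have hlam : ℵ₀ ≤ lam := aleph0_le_continuum.trans hcont
  obtain ⟨P, hPcard, hPc, hP⟩ := exists_covering_family hcont hT hM.2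
  -- Branch-supported elements need not be torsion, hence the intersection.
  let K := AddSubgroup.closure (⋃ Y : P, branchSupported M.F Y.1) ⊓ torsionProduct p M.P
  refine ⟨K, inferInstance, isReducedSeparable_of_le_torsionProduct hp.ne_zero inf_le_right,
    ?_, fun G _ hG hGc => ?_⟩
  · refine (mk_le_mk_of_subset (inf_le_left : K ≤ _)).trans
      ((AddSubgroup.mk_closure_le _).trans (max_le ?_ hlam))
    exact mk_iUnion_le_of_le hlam (lift_le.2 hPcard) fun Y =>
      mk_branchSupported_le M.F (hPc _ Y.2) hcont hM.1
  let I : ℕ → Type u := fun m => (l m).out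
  have hI : #(∀ m, I m) = Cardinal.prod l := by simp [I]
  obtain ⟨φ, hφ⟩ := exists_embedding_torsionProduct hp (I := I)
    (fun a b h => by simpa [I] using hmono h) (hlam.trans (hI ▸ hprod)) hG
    (hGc.trans (hI ▸ hprod))
  obtain ⟨d⟩ : Nonempty (∀ m, I m) := by
    rw [← mk_ne_zero_iff, hI]
    exact (aleph0_pos.trans_le (hlam.trans hprod)).ne'
  -- The base point `d m` makes every factor of the product nonempty, as n_i ≥ 1 requires.
  let s : G → ∀ m, Finset (I m) := fun a m => insert (d m) ((φ a).1 m).support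
  -- Branches are tagged with the group element, so each element contributes its own full product of
  -- finite sets.
  let N : FcStructure.{u} :=
    { P := I
      Pω := Σ a : G, ∀ m, Fin (s a m).card
      F := fun m y => (s y.1 m).equivFin.symm (y.2 m) }
  obtain ⟨g, gω, hg, -, hF⟩ := huniv N ⟨fun m => by simp [N, I], by
    have hinj : Function.Injective
        (fun y : N.Pω => ((y.1, fun m => (y.2 m : ℕ)) : G × (ℕ → ℕ))) := by
      rintro ⟨a, η⟩ ⟨b, ζ⟩ h
      obtain rfl : a = b := congrArg Prod.fst h
      have : η = ζ := funext fun m => Fin.ext (congrFun (congrArg Prod.snd h) m)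
      rw [this]
    refine (mk_le_of_injective hinj).trans ?_
    rw [mk_prod]
    exact mul_le_of_le hlam (by simpa using hGc) (by simpa using hcont)⟩
  let ψ : (∀ m, I m →₀ UnitAddCircle) →+ ∀ m, M.P m →₀ UnitAddCircle :=
    AddMonoidHom.pi fun m => (Finsupp.mapDomain.addMonoidHom (g m)).comp
      (Pi.evalAddMonoidHom _ m)
  have hψ : Function.Injective ψ := fun x y h =>
    funext fun m => Finsupp.mapDomain_injective (hg m) (congrFun h m)
  have hψT : ∀ x ∈ torsionProduct p I, ψ x ∈ torsionProduct p M.P := by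
    rintro x ⟨h, k, hk⟩
    refine ⟨fun m => ?_, k, by rw [← map_nsmul, hk, map_zero]⟩
    change p ^ (m + 1) • Finsupp.mapDomain.addMonoidHom (g m) (x m) = 0
    rw [← map_nsmul, h m, map_zero]
  have hmem : ∀ a, ψ (φ a).1 ∈ K := fun a => by
    refine ⟨AddSubgroup.subset_closure ?_, hψT _ (φ a).2⟩
    obtain ⟨Y, hY, hx⟩ := mem_branchSupported_of_forall_branch (F := M.F) hP (s := s a)
      (g := g) (x := ψ (φ a).1) (fun m => Finset.insert_nonempty _ _) (fun η => gω ⟨a, η⟩)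
      (fun η m => hF m ⟨a, η⟩) fun m => by
        refine (Finset.coe_subset.2 Finsupp.mapDomain_support).trans ?_
        rw [Finset.coe_image]
        exact Set.image_mono (Finset.coe_subset.2 (Finset.subset_insert _ _))
    exact Set.mem_iUnion.2 ⟨⟨Y, hY⟩, hx⟩
  refine ⟨(ψ.comp ((torsionProduct p I).subtype.comp φ)).codRestrict K hmem, fun a b h => ?_⟩
  exact hφ (Subtype.ext (hψ (congrArg Subtype.val h)))

theorem isReducedSeparable_of_nsmul_eq_zero {p : ℕ} (hp : p ≠ 0) {G : Type u} [AddCommGroup G]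
    (h : ∀ x : G, p • x = 0) : IsReducedSeparable p G :=
  .of_isPGroup_of_separable hp (fun x => ⟨1, by rw [pow_one, h]⟩) fun x hx => by
    obtain ⟨y, rfl⟩ := hx 1
    rw [pow_one, h]

theorem theorem6p1 (p : ℕ) (hp : p.Prime) (lam : Cardinal.{u}) (l : ℕ → Cardinal.{u})
    (hcont : Cardinal.continuum ≤ lam)
    (hT : ∀ n : ℕ → ℕ, (∀ i, 1 ≤ n i) →
      coveringNumber (nowhereDenseIdeal n) Cardinal.aleph0 lam = lam)
    (hmono : ∀ n, l n ≤ l (n + 1)) (hle : ∀ n, l n ≤ lam)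
    (hprod : lam ≤ Cardinal.prod l) :
    ((∃ M : FcStructure.{u}, M.InClass l lam ∧
        ∀ N : FcStructure.{u}, N.InClass l lam → N.EmbedsInto M) →
      ∃ (H : Type u) (_ : AddCommGroup H), IsUniversalRs p lam H) ∧
    ((∃ M : FcStructure.{u}, M.InClass (fun _ => lam) lam ∧
        ∀ N : FcStructure.{u}, N.InClass l lam → N.EmbedsInto M) →
      ∃ (H : Type u) (_ : AddCommGroup H),
        IsUniversalInRsClass p l lam H ∧ IsUniversalInRsClass p (fun _ => lam) lam H ∧
          IsUniversalRs p lam H) := by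
  have hlam : ℵ₀ ≤ lam := aleph0_le_continuum.trans hcont
  have hmono' : Monotone l := monotone_nat_of_le_succ hmono
  have main : (∃ M : FcStructure.{u}, M.InClass (fun _ => lam) lam ∧
        ∀ N : FcStructure.{u}, N.InClass l lam → N.EmbedsInto M) →
      ∃ (H : Type u) (_ : AddCommGroup H),
        IsUniversalInRsClass p l lam H ∧ IsUniversalInRsClass p (fun _ => lam) lam H ∧
          IsUniversalRs p lam H := by
    rintro ⟨M, hM, huniv⟩
    have : Fact p.Prime := ⟨hp⟩
    obtain ⟨H, _, hH, hHc, hHu⟩ :=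
      exists_universal_of_universal_fcStructure hp hcont hT hmono' hprod hM huniv
    let I : ℕ → Type u := fun m => (l m).out
    have hI : #(∀ m, I m) = Cardinal.prod l := by simp [I]
    -- The parts of `M` may have size λ, which gives no bound by `l n`. Returning to the index sets
    -- of size `l n` restores it.
    obtain ⟨φ, hφ⟩ := exists_embedding_torsionProduct hp (I := I)
      (fun a b h => by simpa [I] using hmono' h) (hlam.trans (hI ▸ hprod)) hH
      (hHc.trans (hI ▸ hprod))
    let ψ : H →+ ∀ m, I m →₀ UnitAddCircle := (torsionProduct p I).subtype.comp φ
    have hψ : Function.Injective ψ := (torsionProduct p I).subtype_injective.comp hφ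
    have hψT : ψ.range ≤ torsionProduct p I := by
      rintro _ ⟨a, rfl⟩
      exact (φ a).2
    obtain ⟨K, hψK, hKT, hKc, hpure⟩ :=
      AddSubgroup.exists_pure_le _ ψ.range hψT hlam (mk_range_le.trans hHc)
    have hK : IsReducedSeparable p K := isReducedSeparable_of_le_torsionProduct hp.ne_zero hKT
    have hKu : ∀ (G : Type u) [AddCommGroup G], IsReducedSeparable p G → #G ≤ lam →
        GroupEmbeds G K := fun G _ hG hGc => by
      obtain ⟨f, hf⟩ := hHu G hG hGc
      refine ⟨(ψ.comp f).codRestrict K fun a => hψK ⟨f a, rfl⟩, fun a b h => ?_⟩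
      have h' := congrArg K.subtype h
      exact hf (hψ h')
    -- The lower bound comes from universality, applied to an elementary abelian group of size λ.
    have hKcard : #K = lam := by
      have : Nonempty lam.out := mk_ne_zero_iff.1 (by
        rw [mk_out]; exact (aleph0_pos.trans_le hlam).ne')
      have : Infinite lam.out := infinite_iff.2 (by rwa [mk_out])
      have hcard : #(lam.out →₀ ZMod p) = lam := by
        rw [mk_finsupp_lift_of_infinite, mk_out, lift_uzero, max_eq_left]
        refine (lift_le_aleph0.2 (mk_le_aleph0_iff.2 inferInstance)).trans hlam
      obtain ⟨f, hf⟩ := hKu (lam.out →₀ ZMod p) (isReducedSeparable_of_nsmul_eq_zero hp.ne_zero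
        fun x => Finsupp.ext fun i => by simp) hcard.le
      exact hKc.antisymm (hcard.symm.trans_le (mk_le_of_injective hf))
    have hulm : ∀ n, ulmInvariant p n K ≤ l n := fun n =>
      (ulmInvariant_le_of_pure hp hKT hpure n).trans_eq (mk_out _)
    exact ⟨K, inferInstance, ⟨⟨hK, hKcard, hulm⟩, fun G _ hG => hKu G hG.1 hG.2.1.le⟩,
      ⟨⟨hK, hKcard, fun n => (hulm n).trans (hle n)⟩, fun G _ hG => hKu G hG.1 hG.2.1.le⟩,
      ⟨hK, hKcard⟩, hKu⟩
  refine ⟨?_, main⟩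
  rintro ⟨M, hM, huniv⟩
  obtain ⟨H, hH, -, -, h⟩ := main ⟨M, ⟨fun n => (hM.1 n).trans (hle n), hM.2⟩, huniv⟩
  exact ⟨H, hH, h⟩
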